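/- Let $\Lambda$ be an Artin algebra, i.e. an algebra that is finitely generated as a module over a commutative Artinian ring $R$, let $n \ge 0$ be an integer, and let $\Lambda\text{-mod}$ be the category of finitely generated left $\Lambda$-modules. Suppose that $\Lambda$ is $(n+1)$-Gorenstein: the injective dimensions of $\Lambda$ as a left module and as a right module over itself are both finite, and the injective dimension of the left module ${}_\Lambda\Lambda$ equals $n+1$. Then the following are equivalent: 1. $\Lambda$ is a minimal $n$-Auslander-Gorenstein algebra, that is, $\operatorname{id} {}_\Lambda\Lambda \le n+1 \le \operatorname{domdim} \Lambda$; 2. $\operatorname{prinj}(\Lambda) = \{ I \in \Lambda\text{-mod} \mid I \text{ is injective and } \operatorname{Gpd}(\operatorname{soc} I) \le n \}$. Here $\operatorname{prinj}(\Lambda)$ is the class of modules in $\Lambda\text{-mod}$ that are both projective and injective; $\operatorname{soc} I$ is the sum of the simple submodules of $I$; $\operatorname{domdim} \Lambda$ is the supremum in $\{0,1,2,\dots,\infty\}$ of the $t$ such that in the minimal injective coresolution $0 \to {}_\Lambda\Lambda \to I_0 \to I_1 \to \cdots$ the module $I_j$ is projective for all $j < t$; and $\operatorname{Gpd} N$ is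 the least $k$ for which there is an exact sequence $0 \to G_k \to \cdots \to G_0 \to N \to 0$ with all $G_i$ Gorenstein projective ($\infty$ if there is none). A module is Gorenstein projective if it is isomorphic to $\ker d^0$ for an exact complex $(P^i, d^i)_{i \in \mathbb{Z}}$ of finitely generated projective left $\Lambda$-modules that stays exact under $\operatorname{Hom}_\Lambda(-, \Lambda)$. -/

import Mathlib

open CategoryTheory

universe v u

namespace AuslanderGorenstein

/-- The socle of a module: the sum of its simple submodules. -/
def socle (Λ : Type u) [Ring Λ] (M : Type u) [AddCommGroup M] [Module Λ M] : Submodule Λ M :=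
  sSup {S : Submodule Λ M | IsSimpleModule Λ S}

/-- A submodule is essential if it meets every nonzero submodule nontrivially. -/
def IsEssential {Λ : Type u} [Ring Λ] {M : Type u} [AddCommGroup M] [Module Λ M]
    (N : Submodule Λ M) : Prop :=
  ∀ K : Submodule Λ M, N ⊓ K = ⊥ → K = ⊥

/-- A minimal injective coresolution `0 → M → I 0 → I 1 → ⋯` by finitely generated injective
modules: an exact sequence in which `I 0` is an injective envelope of `M` and every `I (j + 1)`
is an injective envelope of the image of `d j`. -/
structure MinimalInjectiveCoresolution (Λ : Type u) [Ring Λ]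
    (M : Type u) [AddCommGroup M] [Module Λ M] where
  I : ℕ → ModuleCat.{u} Λ
  ε : M →ₗ[Λ] I 0
  d : ∀ j : ℕ, I j →ₗ[Λ] I (j + 1)
  finite : ∀ j, Module.Finite Λ (I j)
  injective : ∀ j, Module.Injective Λ (I j)
  ε_injective : Function.Injective ε
  exact_zero : Function.Exact ε (d 0)
  exact_succ : ∀ j, Function.Exact (d j) (d (j + 1))
  essential_ε : IsEssential (LinearMap.range ε)
  essential_d : ∀ j, IsEssential (LinearMap.range (d j))

/-- The dominant dimension of `Λ`: the supremum of the `t` such that, in the minimal injective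
coresolution `0 → Λ → I 0 → I 1 → ⋯` of the left regular module, `I j` is projective for all
`j < t`. -/
noncomputable def dominantDimension (Λ : Type u) [Ring Λ] : ℕ∞ :=
  sSup {t : ℕ∞ | ∃ C : MinimalInjectiveCoresolution Λ Λ,
    ∀ j : ℕ, (j : ℕ∞) < t → Module.Projective Λ (C.I j)}

/-- The injective dimension of the left regular module. The injective dimension of the right
regular module is `selfInjectiveDimension Λᵐᵒᵖ`. -/
noncomputable def selfInjectiveDimension (Λ : Type u) [Ring Λ] : WithBot ℕ∞ :=
  injectiveDimension (ModuleCat.of Λ Λ)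

/-- `Λ` is `m`-Gorenstein: the regular module has finite injective dimension on both sides,
and the injective dimension of the left regular module is `m`. (For Artin algebras the two
injective dimensions then agree.) -/
structure IsGorensteinOfDimension (m : ℕ) (Λ : Type u) [Ring Λ] : Prop where
  left_eq : selfInjectiveDimension Λ = (m : WithBot ℕ∞)
  right_finite : selfInjectiveDimension Λᵐᵒᵖ < ⊤

/-- `Λ` is minimal `n`-Auslander-Gorenstein: `id Λ ≤ n + 1 ≤ domdim Λ`. -/
structure IsMinimalAuslanderGorenstein (n : ℕ) (Λ : Type u) [Ring Λ] : Prop where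
  selfInjectiveDimension_le : selfInjectiveDimension Λ ≤ ((n + 1 : ℕ) : WithBot ℕ∞)
  le_dominantDimension : ((n + 1 : ℕ) : ℕ∞) ≤ dominantDimension Λ

/-- A totally acyclic complex: an exact complex of finitely generated projective modules,
indexed by `ℤ`, which stays exact under `Hom(-, Λ)`. -/
structure TotallyAcyclicComplex (Λ : Type u) [Ring Λ] where
  P : ℤ → ModuleCat.{u} Λ
  d : ∀ i : ℤ, P i →ₗ[Λ] P (i + 1)
  finite : ∀ i, Module.Finite Λ (P i)
  projective : ∀ i, Module.Projective Λ (P i)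
  exact : ∀ i, Function.Exact (d i) (d (i + 1))
  dual_exact : ∀ (i : ℤ) (φ : P (i + 1) →ₗ[Λ] Λ),
    φ ∘ₗ d i = 0 → ∃ ψ : P (i + 1 + 1) →ₗ[Λ] Λ, ψ ∘ₗ d (i + 1) = φ

/-- A (finitely generated) Gorenstein projective module: a module of cocycles of a totally acyclic
complex. -/
def IsGorensteinProjective (Λ : Type u) [Ring Λ] (M : Type u) [AddCommGroup M] [Module Λ M] :
    Prop :=
  ∃ C : TotallyAcyclicComplex Λ, Nonempty (M ≃ₗ[Λ] LinearMap.ker (C.d 0))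

/-- `HasGorensteinResolution Λ k M`: there is an exact sequence
`0 → G k → ⋯ → G 1 → G 0 → M → 0` with all `G i` Gorenstein projective, given by its successive
kernels. -/
def HasGorensteinResolution (Λ : Type u) [Ring Λ] :
    ℕ → ∀ (M : Type u) [AddCommGroup M] [Module Λ M], Prop
  | 0, M, _, _ => IsGorensteinProjective Λ M
  | k + 1, M, _, _ => ∃ (G : ModuleCat.{u} Λ) (f : G →ₗ[Λ] M),
      IsGorensteinProjective Λ G ∧ Function.Surjective f ∧
        HasGorensteinResolution Λ k (LinearMap.ker f)

/-- The Gorenstein projective dimension: the least length of a Gorenstein projective resolution,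
and `⊤` if there is none. -/
noncomputable def gorensteinProjectiveDimension (Λ : Type u) [Ring Λ]
    (M : Type u) [AddCommGroup M] [Module Λ M] : ℕ∞ :=
  sInf {t : ℕ∞ | ∃ k : ℕ, t = k ∧ HasGorensteinResolution Λ k M}

/-- The finitely generated modules that are both projective and injective. -/
def prinj (Λ : Type u) [Ring Λ] : ObjectProperty (ModuleCat.{u} Λ) :=
  fun I => Module.Finite Λ I ∧ Module.Projective Λ I ∧ Module.Injective Λ I

/-- The finitely generated injective modules whose socle has Gorenstein projective dimension at
most `n`. -/
def injWithSocleGpdLE (n : ℕ) (Λ : Type u) [Ring Λ] : ObjectProperty (ModuleCat.{u} Λ) :=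
  fun I => Module.Finite Λ I ∧ Module.Injective Λ I ∧
    gorensteinProjectiveDimension Λ (socle Λ I) ≤ n

end AuslanderGorenstein

/-! Everything is measured by vanishing of `Ext` into Λ. Over a Gorenstein Λ, a finitely generated N
has Gpd N ≤ n exactly when Ext^i(N, Λ) = 0 for all i > n (`hasGorensteinResolution_of_extVanish`,
`HasGorensteinResolution.extVanish`). Since id Λ = n + 1, this condition passes to submodules
(`ExtVanish.of_injective`), so the socle of a projective-injective module always satisfies it.

Let I_0, …, I_n be projective, I injective with Gpd(soc I) ≤ n, and S ⊆ I simple. If S had no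
nonzero map to a projective-injective module, then Hom(S, I_l) = 0 for l ≤ n would kill Ext^i(S, Λ)
for i ≤ n, and S ⊆ soc I kills the higher ones. Modules without higher `Ext` into Λ are reflexive,
so S ≅ S** = 0, a contradiction. Hence I embeds in a projective-injective module and splits off
(`projective_of_forall_simple`).

Conversely, if I_l is projective for all l < j ≤ n, the j-th cosyzygy of Λ has projective dimension
at most j. By minimality it contains soc I_j, so Gpd(soc I_j) ≤ n and the assumed equality makes I_j
projective. -/

namespace AuslanderGorenstein
open Abelian

/-! ### Dimension shifting for vanishing of `Ext`. -/

section Ext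

variable {A : Type u} [Ring A]
variable {K P M N X : Type u} [AddCommGroup K] [AddCommGroup P] [AddCommGroup M] [AddCommGroup N]
  [AddCommGroup X] [Module A K] [Module A P] [Module A M] [Module A N] [Module A X]

/-- The vanishing of `Ext^i(M, N)`. -/
def ExtVanish (A : Type u) [Ring A] (M N : Type u) [AddCommGroup M] [AddCommGroup N]
    [Module A M] [Module A N] (i : ℕ) : Prop :=
  ∀ x : Ext (ModuleCat.of A M) (ModuleCat.of A N) i, x = 0

theorem shortExact_of_exact {f : K →ₗ[A] P} {g : P →ₗ[A] M} (hf : Function.Injective f)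
    (hg : Function.Surjective g) (h : Function.Exact f g) :
    (ShortComplex.mk (ModuleCat.ofHom f) (ModuleCat.ofHom g)
      (by ext x; exact h.apply_apply_eq_zero x)).ShortExact :=
  ModuleCat.shortComplex_shortExact _ h hf hg

theorem ExtVanish.quotient {f : K →ₗ[A] P} {g : P →ₗ[A] M} (hf : Function.Injective f)
    (hg : Function.Surjective g) (h : Function.Exact f g) {i : ℕ}
    (hK : ExtVanish A K N i) (hP : ExtVanish A P N (i + 1)) : ExtVanish A M N (i + 1) := by
  intro x
  obtain ⟨y, rfl⟩ := Ext.contravariant_sequence_exact₃ (shortExact_of_exact hf hg h) _ x (hP _)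
    (add_comm 1 i)
  rw [hK y, Ext.comp_zero]

theorem ExtVanish.submodule {f : K →ₗ[A] P} {g : P →ₗ[A] M} (hf : Function.Injective f)
    (hg : Function.Surjective g) (h : Function.Exact f g) {i : ℕ}
    (hP : ExtVanish A P N i) (hM : ExtVanish A M N (i + 1)) : ExtVanish A K N i := by
  intro x
  obtain ⟨y, rfl⟩ := Ext.contravariant_sequence_exact₁ (shortExact_of_exact hf hg h) _ x
    (add_comm 1 i) (hM _)
  rw [hP y, Ext.comp_zero]

theorem ExtVanish.covariant {f : K →ₗ[A] P} {g : P →ₗ[A] M} (hf : Function.Injective f)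
    (hg : Function.Surjective g) (h : Function.Exact f g) {i : ℕ}
    (hM : ExtVanish A X M i) (hP : ExtVanish A X P (i + 1)) : ExtVanish A X K (i + 1) := by
  intro x
  obtain ⟨y, rfl⟩ := Ext.covariant_sequence_exact₁ _ (shortExact_of_exact hf hg h) x (hP _) rfl
  rw [hM y, Ext.zero_comp]

theorem extVanish_of_projective [Module.Projective A P] (i : ℕ) : ExtVanish A P N (i + 1) := by
  have : Projective (ModuleCat.of A P) := (IsProjective.iff_projective P).1 inferInstance
  exact fun x ↦ Ext.eq_zero_of_projective x

theorem extVanish_of_injective [Module.Injective A N] (i : ℕ) : ExtVanish A M N (i + 1) := by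
  have := Module.injective_object_of_injective_module A N
  exact fun x ↦ Ext.eq_zero_of_injective x

theorem extVanish_zero (h : ∀ f : M →ₗ[A] N, f = 0) : ExtVanish A M N 0 := by
  intro x
  rw [← Ext.mk₀_addEquiv₀_apply x]
  have : Ext.addEquiv₀ x = 0 := by
    ext1; exact h _
  rw [this, Ext.mk₀_zero]

theorem ExtVanish.retract {s : M →ₗ[A] P} {r : P →ₗ[A] M} (h : r ∘ₗ s = LinearMap.id) {i : ℕ}
    (hP : ExtVanish A P N i) : ExtVanish A M N i := by
  intro x
  have : (Ext.mk₀ (ModuleCat.ofHom s)).comp ((Ext.mk₀ (ModuleCat.ofHom r)).comp x (zero_add i))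
      (zero_add i) = x := by
    rw [Ext.mk₀_comp_mk₀_assoc, ← ModuleCat.ofHom_comp, h]
    exact Ext.mk₀_id_comp x
  rw [← this, hP ((Ext.mk₀ (ModuleCat.ofHom r)).comp x (zero_add i)), Ext.comp_zero]

theorem ExtVanish.congr (e : M ≃ₗ[A] P) {i : ℕ} (hP : ExtVanish A P N i) : ExtVanish A M N i :=
  hP.retract (s := e.toLinearMap) (r := e.symm.toLinearMap) (by ext; simp)

theorem ExtVanish.congr_right (e : N ≃ₗ[A] X) {i : ℕ} (h : ExtVanish A M X i) :
    ExtVanish A M N i := by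
  intro x
  have : (x.comp (Ext.mk₀ (ModuleCat.ofHom e.toLinearMap)) (add_zero i)).comp
      (Ext.mk₀ (ModuleCat.ofHom e.symm.toLinearMap)) (add_zero i) = x := by
    rw [Ext.comp_assoc_of_third_deg_zero, Ext.mk₀_comp_mk₀, ← ModuleCat.ofHom_comp,
      LinearEquiv.symm_comp]
    exact Ext.comp_mk₀_id x
  rw [← this, h (x.comp (Ext.mk₀ (ModuleCat.ofHom e.toLinearMap)) (add_zero i)), Ext.zero_comp]

theorem ExtVanish.exists_extension {f : K →ₗ[A] P} {g : P →ₗ[A] M} (hf : Function.Injective f)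
    (hg : Function.Surjective g) (h : Function.Exact f g) (hM : ExtVanish A M N 1)
    (φ : K →ₗ[A] N) : ∃ ψ : P →ₗ[A] N, ψ ∘ₗ f = φ := by
  obtain ⟨y, hy⟩ := Ext.contravariant_sequence_exact₁ (shortExact_of_exact hf hg h) _
    (Ext.mk₀ (ModuleCat.ofHom φ)) (add_zero 1) (hM _)
  obtain ⟨ψ, rfl⟩ := Ext.addEquiv₀.symm.surjective y
  refine ⟨ψ.hom, ?_⟩
  erw [Ext.mk₀_comp_mk₀] at hy
  have := Ext.addEquiv₀.symm.injective hy
  exact congrArg ModuleCat.Hom.hom this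

theorem extVanish_one_of_exists_extension [Module.Projective A P] {f : K →ₗ[A] P} {g : P →ₗ[A] M}
    (hf : Function.Injective f) (hg : Function.Surjective g) (h : Function.Exact f g)
    (H : ∀ φ : K →ₗ[A] N, ∃ ψ : P →ₗ[A] N, ψ ∘ₗ f = φ) : ExtVanish A M N 1 := by
  intro x
  obtain ⟨y, rfl⟩ := Ext.contravariant_sequence_exact₃ (shortExact_of_exact hf hg h) _ x
    (extVanish_of_projective 0 _) (add_zero 1)
  obtain ⟨φ, rfl⟩ := Ext.addEquiv₀.symm.surjective y
  obtain ⟨ψ, hψ⟩ := H φ.hom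
  have : Ext.addEquiv₀.symm φ = (Ext.mk₀ (ModuleCat.ofHom f)).comp
      (Ext.mk₀ (ModuleCat.ofHom ψ)) (add_zero 0) := by
    have hφ : φ = ModuleCat.ofHom f ≫ ModuleCat.ofHom ψ := by ext1; exact hψ.symm
    rw [Ext.mk₀_comp_mk₀, hφ]
    rfl
  rw [this]
  exact (shortExact_of_exact hf hg h).extClass_comp_assoc _

theorem extVanish_of_injectiveDimension_le {m : ℕ}
    (h : injectiveDimension (ModuleCat.of A N) ≤ m) {i : ℕ} (hi : m < i) : ExtVanish A M N i := by
  have := (injectiveDimension_le_iff _ _).1 h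
  exact fun x ↦ x.eq_zero_of_hasInjectiveDimensionLT (m + 1) hi

end Ext

end AuslanderGorenstein

namespace AuslanderGorenstein

/-! ### The duality Hom(-, U) on modules without higher `Ext` into U. -/

section Duality

theorem exists_factor_of_exact {A : Type u} [Ring A] {K P M N : Type u} [AddCommGroup K]
    [AddCommGroup P] [AddCommGroup M] [AddCommGroup N] [Module A K] [Module A P] [Module A M]
    [Module A N] {f : K →ₗ[A] P} {g : P →ₗ[A] M} (hg : Function.Surjective g)
    (h : Function.Exact f g) (φ : P →ₗ[A] N) (hφ : φ ∘ₗ f = 0) : ∃ ψ : M →ₗ[A] N, ψ ∘ₗ g = φ := by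
  have hker : LinearMap.ker g ≤ LinearMap.ker φ := by
    intro x hx
    obtain ⟨k, rfl⟩ := (h x).1 hx
    exact LinearMap.congr_fun hφ k
  refine ⟨(Submodule.liftQ _ φ hker) ∘ₗ (g.quotKerEquivOfSurjective hg).symm.toLinearMap, ?_⟩
  ext x
  have : (g.quotKerEquivOfSurjective hg).symm (g x) = Submodule.Quotient.mk x := by
    rw [LinearEquiv.symm_apply_eq]; rfl
  simp [this]

theorem exists_surjective_onto_ker {A : Type u} [Ring A] {X Y Z : Type u} [AddCommGroup X]
    [AddCommGroup Y] [AddCommGroup Z] [Module A X] [Module A Y] [Module A Z] {f : X →ₗ[A] Y}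
    {f' : Y →ₗ[A] Z} (h : Function.Exact f f') :
    ∃ g : X →ₗ[A] LinearMap.ker f', Function.Surjective g ∧ (∀ x, (g x : Y) = f x) ∧
      Function.Exact (LinearMap.ker f).subtype g := by
  refine ⟨f.codRestrict _ fun x ↦ (h _).2 ⟨x, rfl⟩, ?_, fun x ↦ rfl, fun x ↦ ?_⟩
  · rintro ⟨y, hy⟩
    obtain ⟨x, rfl⟩ := (h y).1 hy
    exact ⟨x, rfl⟩
  · rw [Subtype.ext_iff]
    exact ⟨fun h ↦ ⟨⟨x, h⟩, rfl⟩, fun ⟨y, hy⟩ ↦ hy ▸ y.2⟩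

variable {A B U : Type u} [Ring A] [Ring B] [AddCommGroup U] [Module A U] [Module B U]
  [SMulCommClass A B U]

/-- Finitely generated modules `M` with `Ext^i(M, U) = 0` for all `i ≥ 1`. -/
structure IsPerp (A U : Type u) [Ring A] [AddCommGroup U] [Module A U] (M : Type u)
    [AddCommGroup M] [Module A M] : Prop where
  finite : Module.Finite A M
  vanish : ∀ i, ExtVanish A M U (i + 1)

variable {K P M : Type u} [AddCommGroup K] [AddCommGroup P] [AddCommGroup M]
  [Module A K] [Module A P] [Module A M]

theorem IsPerp.ker [IsNoetherianRing A] [Module.Finite A P] [Module.Projective A P]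
    (g : P →ₗ[A] M) (hg : Function.Surjective g) (hM : IsPerp A U M) :
    IsPerp A U (LinearMap.ker g) :=
  ⟨inferInstance, fun i ↦ ExtVanish.submodule (Submodule.subtype_injective _) hg
    (LinearMap.exact_subtype_ker_map g) (extVanish_of_projective i) (hM.vanish (i + 1))⟩

theorem exact_lcomp {f : K →ₗ[A] P} {g : P →ₗ[A] M}
    (hg : Function.Surjective g) (h : Function.Exact f g) :
    Function.Exact (LinearMap.lcomp B U g) (LinearMap.lcomp B U f) := by
  intro φ
  constructor
  · exact fun hφ ↦ exists_factor_of_exact hg h φ hφ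
  · rintro ⟨ψ, rfl⟩
    ext k
    simp [h.apply_apply_eq_zero]

theorem injective_lcomp {g : P →ₗ[A] M} (hg : Function.Surjective g) :
    Function.Injective (LinearMap.lcomp B U g) := by
  intro φ ψ hφ
  ext x
  obtain ⟨y, rfl⟩ := hg x
  exact LinearMap.congr_fun hφ y

theorem surjective_lcomp {f : K →ₗ[A] P} {g : P →ₗ[A] M} (hf : Function.Injective f)
    (hg : Function.Surjective g) (h : Function.Exact f g) (hM : ExtVanish A M U 1) :
    Function.Surjective (LinearMap.lcomp B U f) :=
  fun φ ↦ hM.exists_extension hf hg h φ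

theorem projective_pi {ι : Type*} [Finite ι] (Q : ι → Type u) [∀ i, AddCommGroup (Q i)]
    [∀ i, Module A (Q i)] [∀ i, Module.Projective A (Q i)] : Module.Projective A (∀ i, Q i) := by
  classical
  have := Fintype.ofFinite ι
  exact Module.Projective.of_equiv (DFinsupp.linearEquivFunOnFintype (R := A) (M := Q))

/-- The dual of a free module of rank `n` is `U ^ n`. -/
noncomputable def dualPiEquiv (A B U : Type u) [Ring A] [Ring B] [AddCommGroup U] [Module A U]
    [Module B U] [SMulCommClass A B U] (n : ℕ) :
    ((Fin n → A) →ₗ[A] U) ≃ₗ[B] (Fin n → U) :=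
  LinearEquiv.ofBijective
    { toFun := fun φ i ↦ φ (Pi.single i 1)
      map_add' := fun _ _ ↦ rfl
      map_smul' := fun _ _ ↦ rfl } <| by
    constructor
    · intro φ ψ h
      refine LinearMap.pi_ext' fun i ↦ LinearMap.ext_ring ?_
      exact congrFun h i
    · intro v
      refine ⟨∑ i, (LinearMap.toSpanSingleton A U (v i)) ∘ₗ LinearMap.proj i, ?_⟩
      ext i
      simp [Pi.single_apply, ite_smul]

theorem exists_ker_perp [IsNoetherianRing A] (hM : IsPerp A U M) :
    ∃ (n : ℕ) (g : (Fin n → A) →ₗ[A] M), Function.Surjective g ∧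
      IsPerp A U (LinearMap.ker g) := by
  have := hM.finite
  obtain ⟨n, g, hg⟩ := Module.Finite.exists_fin' A M
  exact ⟨n, g, hg, hM.ker g hg⟩

/-- Dualizing 0 → K → Aⁿ → M → 0 keeps it exact, and the dual of Aⁿ is projective over B. So the
degree for M* can be raised by passing to K*; `m` counts the shifts still needed to reach degree N.
-/
theorem extVanish_dual [IsNoetherianRing A] [Module.Projective B U]
    {N : ℕ} (hN : ∀ (Y : Type u) [AddCommGroup Y] [Module B Y], ∀ i, N ≤ i → ExtVanish B Y U i)
    (m : ℕ) : ∀ (M : Type u) [AddCommGroup M] [Module A M], IsPerp A U M →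
      ∀ i, N ≤ i + m → ExtVanish B (M →ₗ[A] U) U (i + 1) := by
  induction m with
  | zero => exact fun M _ _ _ i hi ↦ hN _ _ (by omega)
  | succ m ih =>
    intro M _ _ hM i hi
    obtain ⟨n, g, hg, hK⟩ := exists_ker_perp hM
    have hex := LinearMap.exact_subtype_ker_map g
    have : Module.Projective B ((Fin n → A) →ₗ[A] U) :=
      have := projective_pi (A := B) fun _ : Fin n ↦ U
      Module.Projective.of_equiv (dualPiEquiv A B U n).symm
    exact ExtVanish.submodule (injective_lcomp (B := B) hg)
      (surjective_lcomp (B := B) (Submodule.subtype_injective _) hg hex (hM.vanish 0))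
      (exact_lcomp hg hex) (extVanish_of_projective i) (ih _ hK (i + 1) (by omega))

theorem IsPerp.dual [IsNoetherianRing A] [IsNoetherianRing B] [Module.Projective B U]
    [Module.Finite B U]
    {N : ℕ} (hN : ∀ (Y : Type u) [AddCommGroup Y] [Module B Y], ∀ i, N ≤ i → ExtVanish B Y U i)
    (hM : IsPerp A U M) : IsPerp B U (M →ₗ[A] U) := by
  refine ⟨?_, fun i ↦ extVanish_dual hN N M hM i (by omega)⟩
  obtain ⟨n, g, hg, -⟩ := exists_ker_perp hM
  have : Module.Finite B ((Fin n → A) →ₗ[A] U) := Module.Finite.equiv (dualPiEquiv A B U n).symm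
  exact Module.Finite.of_injective _ (injective_lcomp (B := B) (U := U) hg)

variable [SMulCommClass B A U]

/-- The evaluation map from a module to its bidual. -/
def bidualEval (A B U : Type u) [Ring A] [Ring B] [AddCommGroup U] [Module A U]
    [Module B U] [SMulCommClass A B U] [SMulCommClass B A U] (M : Type u) [AddCommGroup M]
    [Module A M] : M →ₗ[A] ((M →ₗ[A] U) →ₗ[B] U) where
  toFun x := { toFun := fun φ ↦ φ x, map_add' := fun _ _ ↦ rfl, map_smul' := fun _ _ ↦ rfl }
  map_add' x y := by ext φ; exact φ.map_add x y
  map_smul' a x := by ext φ; exact φ.map_smul a x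

theorem bidualEval_surjective [IsNoetherianRing A] [IsNoetherianRing B] [Module.Projective B U]
    [Module.Finite B U]
    {N : ℕ} (hN : ∀ (Y : Type u) [AddCommGroup Y] [Module B Y], ∀ i, N ≤ i → ExtVanish B Y U i)
    (hfree : ∀ n, Function.Bijective (bidualEval A B U (Fin n → A)))
    (hM : IsPerp A U M) : Function.Surjective (bidualEval A B U M) := by
  obtain ⟨n, g, hg, hK⟩ := exists_ker_perp hM
  have hex := LinearMap.exact_subtype_ker_map g
  intro ξ
  -- Ext¹(K*, U) = 0 makes (Aⁿ)** → M** surjective, and `hfree` lifts η to Aⁿ.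
  obtain ⟨η, rfl⟩ := surjective_lcomp (B := A) (injective_lcomp (B := B) hg)
    (surjective_lcomp (B := B) (Submodule.subtype_injective _) hg hex (hM.vanish 0))
    (exact_lcomp hg hex) ((hK.dual hN).vanish 0) ξ
  obtain ⟨p, rfl⟩ := (hfree n).2 η
  exact ⟨g p, rfl⟩

theorem bidualEval_bijective [IsNoetherianRing A] [IsNoetherianRing B] [Module.Projective B U]
    [Module.Finite B U]
    {N : ℕ} (hN : ∀ (Y : Type u) [AddCommGroup Y] [Module B Y], ∀ i, N ≤ i → ExtVanish B Y U i)
    (hfree : ∀ n, Function.Bijective (bidualEval A B U (Fin n → A)))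
    (hM : IsPerp A U M) : Function.Bijective (bidualEval A B U M) := by
  refine ⟨?_, bidualEval_surjective hN hfree hM⟩
  obtain ⟨n, g, hg, hK⟩ := exists_ker_perp hM
  have hex := LinearMap.exact_subtype_ker_map g
  rw [injective_iff_map_eq_zero]
  intro x hx
  obtain ⟨p, rfl⟩ := hg x
  have hsurj := surjective_lcomp (B := B) (Submodule.subtype_injective _) hg hex (hM.vanish 0)
  -- The image of p in (Aⁿ)** comes from K**, hence from some k in K; injectivity on Aⁿ then forces
  -- p = k.
  obtain ⟨κ, hκ⟩ := (exact_lcomp (B := A) (U := U) hsurj (exact_lcomp hg hex)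
    (bidualEval A B U (Fin n → A) p)).1 hx
  obtain ⟨k, rfl⟩ := bidualEval_surjective hN hfree hK κ
  have : bidualEval A B U (Fin n → A) k = bidualEval A B U (Fin n → A) p := hκ
  rw [← (hfree n).1 this]
  exact k.2

/-- A short exact sequence `0 → X → P → Y → 0` with `P` finitely generated projective. -/
def IsSyzygyOf {A : Type u} [Ring A] (X Y : ModuleCat.{u} A) : Prop :=
  ∃ (P : ModuleCat.{u} A) (f : X →ₗ[A] P) (g : P →ₗ[A] Y), Module.Finite A P ∧
    Module.Projective A P ∧ Function.Injective f ∧ Function.Surjective g ∧ Function.Exact f g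

theorem IsPerp.exists_syzygy [IsNoetherianRing A] (hM : IsPerp A U M) :
    ∃ X : ModuleCat.{u} A, IsPerp A U X ∧ IsSyzygyOf X (ModuleCat.of A M) := by
  obtain ⟨n, g, hg, hK⟩ := exists_ker_perp hM
  exact ⟨ModuleCat.of A (LinearMap.ker g), hK, ModuleCat.of A (Fin n → A),
    (LinearMap.ker g).subtype, g, inferInstanceAs (Module.Finite A (Fin n → A)),
    inferInstanceAs (Module.Projective A (Fin n → A)), Submodule.subtype_injective _, hg,
    LinearMap.exact_subtype_ker_map g⟩

/-- Dualize a presentation 0 → L → Bⁿ → M* → 0 and use M ≅ M**: the cosyzygy is L*. -/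
theorem IsPerp.exists_cosyzygy [IsNoetherianRing A] [IsNoetherianRing B] [Module.Projective B U]
    [Module.Finite B U] [Module.Projective A U] [Module.Finite A U]
    {N : ℕ} (hA : ∀ (Y : Type u) [AddCommGroup Y] [Module A Y], ∀ i, N ≤ i → ExtVanish A Y U i)
    (hB : ∀ (Y : Type u) [AddCommGroup Y] [Module B Y], ∀ i, N ≤ i → ExtVanish B Y U i)
    (hfree : ∀ n, Function.Bijective (bidualEval A B U (Fin n → A)))
    (hM : IsPerp A U M) :
    ∃ Y : ModuleCat.{u} A, IsPerp A U Y ∧ IsSyzygyOf (ModuleCat.of A M) Y := by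
  have hD := hM.dual hB
  obtain ⟨n, g, hg, hL⟩ := exists_ker_perp hD
  have hex := LinearMap.exact_subtype_ker_map g
  have := projective_pi (A := A) fun _ : Fin n ↦ U
  let e := LinearEquiv.ofBijective _ (bidualEval_bijective hB hfree hM)
  refine ⟨ModuleCat.of A (LinearMap.ker g →ₗ[B] U), hL.dual hA,
    ModuleCat.of A ((Fin n → B) →ₗ[B] U), (LinearMap.lcomp A U g) ∘ₗ e.toLinearMap,
    LinearMap.lcomp A U (LinearMap.ker g).subtype, Module.Finite.equiv (dualPiEquiv B A U n).symm,
    Module.Projective.of_equiv (dualPiEquiv B A U n).symm,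
    (injective_lcomp hg).comp e.injective,
    surjective_lcomp (Submodule.subtype_injective _) hg hex (hD.vanish 0), ?_⟩
  intro φ
  rw [exact_lcomp (B := A) (U := U) hg hex φ]
  constructor
  · rintro ⟨x, rfl⟩
    obtain ⟨y, rfl⟩ := e.surjective x
    exact ⟨y, rfl⟩
  · rintro ⟨x, rfl⟩
    exact ⟨e x, rfl⟩

theorem bidualEval_free_bijective (A : Type u) [Ring A] (n : ℕ) :
    Function.Bijective (bidualEval A Aᵐᵒᵖ A (Fin n → A)) := by
  constructor
  · intro x y h
    ext i
    exact LinearMap.congr_fun h (LinearMap.proj i)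
  · intro ξ
    refine ⟨fun i ↦ ξ (LinearMap.proj i), ?_⟩
    ext φ
    -- The coordinate projections generate the dual as a right module, so ξ is determined by its
    -- values on them.
    have hφ : φ = ∑ i, MulOpposite.op (φ (Pi.single i 1)) • (LinearMap.proj i) := by
      refine LinearMap.pi_ext' fun i ↦ LinearMap.ext_ring ?_
      simp [Pi.single_apply]
    conv_rhs => rw [hφ]
    rw [map_sum]
    simp only [map_smul]
    change φ _ = _
    conv_lhs => rw [hφ]
    simp

end Duality

end AuslanderGorenstein

namespace AuslanderGorenstein

/-! ### Gorenstein projective modules and resolutions in terms of `Ext`. -/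

section GorensteinProjective

variable {A : Type u} [Ring A]

theorem exists_int_chain {α : Type*} (r : α → α → Prop) (hs : ∀ x, ∃ y, r x y)
    (hp : ∀ y, ∃ x, r x y) (x : α) : ∃ z : ℤ → α, z 0 = x ∧ ∀ i, r (z i) (z (i + 1)) := by
  choose s hs using hs
  choose p hp using hp
  let z : ℤ → α := fun i ↦ match i with
    | Int.ofNat k => s^[k] x
    | Int.negSucc k => p^[k + 1] x
  refine ⟨z, rfl, fun i ↦ ?_⟩
  match i with
  | Int.ofNat k =>
    change r (s^[k] x) (s^[k + 1] x)
    rw [Function.iterate_succ_apply']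
    exact hs _
  | Int.negSucc 0 => exact hp _
  | Int.negSucc (k + 1) =>
    change r (p^[k + 1 + 1] x) (p^[k + 1] x)
    rw [Function.iterate_succ_apply' p (k + 1)]
    exact hp _

/-- `A` has injective dimension less than `N` as a left and as a right module over itself. -/
structure IsGorensteinLT (N : ℕ) (A : Type u) [Ring A] : Prop where
  left : ∀ (Y : Type u) [AddCommGroup Y] [Module A Y], ∀ i, N ≤ i → ExtVanish A Y A i
  right : ∀ (Y : Type u) [AddCommGroup Y] [Module Aᵐᵒᵖ Y], ∀ i, N ≤ i → ExtVanish Aᵐᵒᵖ Y A i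

/-- Splice the short exact sequences. A map to A killed by the previous differential factors through
some `Z i`, and Ext¹(Z (i + 1), A) = 0 extends it to the next projective. -/
theorem isGorensteinProjective_of_chain (Z : ℤ → ModuleCat.{u} A)
    (hZ : ∀ i, ExtVanish A (Z i) A 1) (h : ∀ i, IsSyzygyOf (Z i) (Z (i + 1))) :
    IsGorensteinProjective A (Z 0) := by
  choose P f g hfin hproj hf hg hex using h
  refine ⟨⟨P, fun i ↦ f (i + 1) ∘ₗ g i, hfin, hproj, fun i y ↦ ?_, fun i φ hφ ↦ ?_⟩, ⟨?_⟩⟩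
  · change f (i + 1 + 1) (g (i + 1) y) = 0 ↔ _
    rw [map_eq_zero_iff _ (hf _), hex (i + 1) y]
    constructor
    · rintro ⟨x, rfl⟩
      obtain ⟨w, rfl⟩ := hg i x
      exact ⟨w, rfl⟩
    · rintro ⟨w, rfl⟩
      exact ⟨g i w, rfl⟩
  · have h1 : φ ∘ₗ f (i + 1) = 0 := by
      ext x
      obtain ⟨w, rfl⟩ := hg i x
      exact LinearMap.congr_fun hφ w
    obtain ⟨φ', rfl⟩ := exists_factor_of_exact (hg (i + 1)) (hex (i + 1)) φ h1
    obtain ⟨ψ, rfl⟩ := (hZ (i + 1 + 1 + 1)).exists_extension (hf (i + 1 + 1)) (hg (i + 1 + 1))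
      (hex (i + 1 + 1)) φ'
    exact ⟨ψ, rfl⟩
  · refine (LinearEquiv.ofInjective (f 0) (hf 0)).trans (LinearEquiv.ofEq _ _ ?_)
    ext x
    rw [LinearMap.mem_range]
    change _ ↔ f (0 + 1) (g 0 x) = 0
    rw [map_eq_zero_iff _ (hf _), hex 0 x, Set.mem_range]

instance finite_mulOpposite_self : Module.Finite Aᵐᵒᵖ A :=
  Module.Finite.of_surjective (LinearMap.toSpanSingleton Aᵐᵒᵖ A 1)
    fun x ↦ ⟨MulOpposite.op x, by simp⟩

theorem projective_mulOpposite_self : Module.Projective Aᵐᵒᵖ A :=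
  Module.Projective.of_equiv (M := Aᵐᵒᵖ) (LinearEquiv.ofBijective
    (LinearMap.toSpanSingleton Aᵐᵒᵖ A 1)
    ⟨fun x y h ↦ by simpa using h, fun x ↦ ⟨MulOpposite.op x, by simp⟩⟩)

variable [IsNoetherianRing A] [IsNoetherianRing Aᵐᵒᵖ]

theorem IsGorensteinLT.exists_cosyzygy {N : ℕ} (hA : IsGorensteinLT N A) {M : Type u}
    [AddCommGroup M] [Module A M] (hM : IsPerp A A M) :
    ∃ Y : ModuleCat.{u} A, IsPerp A A Y ∧ IsSyzygyOf (ModuleCat.of A M) Y := by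
  have := projective_mulOpposite_self (A := A)
  exact hM.exists_cosyzygy (B := Aᵐᵒᵖ) hA.left hA.right (bidualEval_free_bijective A)

theorem IsPerp.isGorensteinProjective {N : ℕ} (hA : IsGorensteinLT N A) {M : Type u}
    [AddCommGroup M] [Module A M] (hM : IsPerp A A M) : IsGorensteinProjective A M := by
  let T := {X : ModuleCat.{u} A // IsPerp A A X}
  obtain ⟨z, h0, hz⟩ := exists_int_chain (α := T) (fun X Y ↦ IsSyzygyOf X.1 Y.1)
    (fun X ↦ by
      obtain ⟨Y, hY, h⟩ := hA.exists_cosyzygy X.2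
      exact ⟨⟨Y, hY⟩, h⟩)
    (fun Y ↦ by
      obtain ⟨X, hX, h⟩ := Y.2.exists_syzygy
      exact ⟨⟨X, hX⟩, h⟩)
    ⟨ModuleCat.of A M, hM⟩
  have := isGorensteinProjective_of_chain (fun i ↦ (z i).1) (fun i ↦ (z i).2.vanish 0) hz
  rwa [h0] at this

/-- Each free cover lowers the vanishing threshold by one; the k-th syzygy has no higher `Ext` into
A and is therefore Gorenstein projective. -/
theorem hasGorensteinResolution_of_extVanish {N : ℕ} (hA : IsGorensteinLT N A) (k : ℕ) :
    ∀ (M : Type u) [AddCommGroup M] [Module A M] [Module.Finite A M],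
      (∀ i, k ≤ i → ExtVanish A M A (i + 1)) → HasGorensteinResolution A k M := by
  induction k with
  | zero => exact fun M _ _ _ h ↦ IsPerp.isGorensteinProjective hA ⟨‹_›, fun i ↦ h i i.zero_le⟩
  | succ k ih =>
    intro M _ _ _ h
    obtain ⟨n, g, hg⟩ := Module.Finite.exists_fin' A M
    refine ⟨ModuleCat.of A (Fin n → A), g,
      IsPerp.isGorensteinProjective (M := Fin n → A) hA
        ⟨inferInstance, fun i ↦ extVanish_of_projective i⟩, hg, ?_⟩
    refine ih _ fun i hi ↦ ?_
    exact ExtVanish.submodule (Submodule.subtype_injective _) hg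
      (LinearMap.exact_subtype_ker_map g) (extVanish_of_projective i) (h _ (by omega))

omit [IsNoetherianRing A] [IsNoetherianRing Aᵐᵒᵖ] in
theorem TotallyAcyclicComplex.extVanish_ker (C : TotallyAcyclicComplex A) (i : ℕ) :
    ∀ j : ℤ, ExtVanish A (LinearMap.ker (C.d j)) A (i + 1) := by
  have key := fun j ↦ exists_surjective_onto_ker (C.exact j)
  have := C.projective
  induction i with
  | zero =>
    intro j
    -- A map φ on the kernel in P (k + 2) is pulled back to P (k + 1), where it kills the
    -- differential from P k; `dual_exact` at k extends it to P (k + 2).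
    obtain ⟨j, rfl⟩ : ∃ k, j = k + 1 + 1 + 1 := ⟨j - 3, by ring⟩
    obtain ⟨g, hg, -, hex⟩ := key (j + 1 + 1)
    refine extVanish_one_of_exists_extension (Submodule.subtype_injective _) hg hex fun φ ↦ ?_
    obtain ⟨g', hg', hgd', -⟩ := key (j + 1)
    have h0 : (φ ∘ₗ g') ∘ₗ C.d j = 0 := by
      ext x
      have : g' (C.d j x) = 0 := Subtype.ext ((hgd' _).trans ((C.exact j _).2 ⟨x, rfl⟩))
      simp [this]
    obtain ⟨ψ, hψ⟩ := C.dual_exact j (φ ∘ₗ g') h0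
    refine ⟨ψ, ?_⟩
    ext x
    obtain ⟨y, rfl⟩ := hg' x
    have := LinearMap.congr_fun hψ y
    simpa [hgd'] using this
  | succ i ih =>
    intro j
    obtain ⟨j, rfl⟩ : ∃ k, j = k + 1 := ⟨j - 1, by ring⟩
    obtain ⟨g, hg, -, hex⟩ := key j
    exact ExtVanish.quotient (Submodule.subtype_injective _) hg hex (ih j)
      (extVanish_of_projective _)

omit [IsNoetherianRing A] [IsNoetherianRing Aᵐᵒᵖ] in
theorem HasGorensteinResolution.extVanish (k : ℕ) :
    ∀ (M : Type u) [AddCommGroup M] [Module A M], HasGorensteinResolution A k M →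
      ∀ i, k ≤ i → ExtVanish A M A (i + 1) := by
  induction k with
  | zero =>
    rintro M _ _ ⟨C, ⟨e⟩⟩ i -
    exact (C.extVanish_ker i 0).congr e
  | succ k ih =>
    rintro M _ _ ⟨G, f, ⟨C, ⟨e⟩⟩, hf, hK⟩ i hi
    obtain ⟨i, rfl⟩ : ∃ l, i = l + 1 := ⟨i - 1, by omega⟩
    exact ExtVanish.quotient (Submodule.subtype_injective _) hf
      (LinearMap.exact_subtype_ker_map f) (ih _ hK i (by omega)) ((C.extVanish_ker _ 0).congr e)

end GorensteinProjective

end AuslanderGorenstein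

namespace AuslanderGorenstein

/-! ### Injective envelopes and minimal injective coresolutions. -/

section InjectiveHull

variable {Λ : Type u} [Ring Λ]

theorem injective_of_retract {M Q : Type u} [AddCommGroup M] [AddCommGroup Q] [Module Λ M]
    [Module Λ Q] [Module.Injective Λ Q] (s : M →ₗ[Λ] Q) (r : Q →ₗ[Λ] M)
    (h : ∀ x, r (s x) = x) : Module.Injective Λ M where
  out X Y _ _ _ _ f hf g := by
    obtain ⟨k, hk⟩ := Module.Injective.out f hf (s ∘ₗ g)
    exact ⟨r ∘ₗ k, fun x ↦ by simp [hk, h]⟩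

theorem exists_maximal_disjoint {Q : Type u} [AddCommGroup Q] [Module Λ Q] (N : Submodule Λ Q) :
    ∃ K : Submodule Λ Q, N ⊓ K = ⊥ ∧ ∀ L, K ≤ L → N ⊓ L = ⊥ → L = K := by
  obtain ⟨K, -, hK⟩ := zorn_le_nonempty₀ {K : Submodule Λ Q | N ⊓ K = ⊥}
    (fun c hc hchain y hy ↦ by
      refine ⟨sSup c, ?_, fun z hz ↦ le_sSup hz⟩
      rw [Set.mem_ofPred_eq, eq_bot_iff]
      rintro x ⟨hxN, hx⟩
      obtain ⟨K, hK, hxK⟩ := (Submodule.mem_sSup_of_directed ⟨y, hy⟩ hchain.directedOn).1 hx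
      have : N ⊓ K = ⊥ := hc hK
      rw [← this]
      exact ⟨hxN, hxK⟩) ⊥ (by simp)
  exact ⟨K, hK.prop, fun L hKL hL ↦ (hK.eq_of_le hL hKL).symm⟩

/-- Every module over any ring has an injective envelope. -/
theorem exists_injective_hull (M : Type u) [AddCommGroup M] [Module Λ M] :
    ∃ (E : ModuleCat.{u} Λ) (ι : M →ₗ[Λ] E), Module.Injective Λ E ∧ Function.Injective ι ∧
      IsEssential (LinearMap.range ι) := by
  let pres := (EnoughInjectives.presentation (ModuleCat.of Λ M)).some
  let Q := pres.J
  have : Injective (ModuleCat.of Λ Q) := pres.injective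
  have : Module.Injective Λ Q := Module.injective_module_of_injective_object Λ Q
  let ι₀ : M →ₗ[Λ] Q := pres.f.hom
  have hι₀ : Function.Injective ι₀ := (ModuleCat.mono_iff_injective pres.f).1 pres.mono
  let N₀ := LinearMap.range ι₀
  -- N is a maximal essential extension of M inside Q. For K maximal with N ∩ K = 0, N is essential
  -- in Q/K, so N ⊆ Q extends to an injective h : Q/K → Q. Its image is again essential over M,
  -- hence equals N, and N is a retract of Q.
  obtain ⟨N, -, hN⟩ := zorn_le_nonempty₀
    {N : Submodule Λ Q | N₀ ≤ N ∧ ∀ K ≤ N, N₀ ⊓ K = ⊥ → K = ⊥}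
    (fun c hc hchain y hy ↦ by
      refine ⟨sSup c, ⟨(hc hy).1.trans (le_sSup hy), fun K hK hNK ↦ ?_⟩, fun z hz ↦ le_sSup hz⟩
      rw [eq_bot_iff]
      intro x hx
      obtain ⟨N, hN, hxN⟩ :=
        (Submodule.mem_sSup_of_directed ⟨y, hy⟩ hchain.directedOn).1 (hK hx)
      have := (hc hN).2 (Submodule.span Λ {x}) (by simpa using hxN)
        (eq_bot_iff.2 ((inf_le_inf_left _ (by simpa using hx)).trans hNK.le))
      simpa using this) N₀ ⟨le_rfl, fun K hK h ↦ by rwa [inf_eq_right.2 hK] at h⟩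
  obtain ⟨⟨hN₀, hess⟩, hmax⟩ := hN
  obtain ⟨K, hNK, hK⟩ := exists_maximal_disjoint N
  have hmem : ∀ x ∈ N, x ∈ K → x = 0 := fun x h1 h2 ↦ by
    have : x ∈ N ⊓ K := ⟨h1, h2⟩
    simpa [hNK] using this
  let j : N →ₗ[Λ] Q ⧸ K := K.mkQ ∘ₗ N.subtype
  have hj : Function.Injective j := by
    rw [injective_iff_map_eq_zero]
    intro x hx
    exact Subtype.ext (hmem x x.2 (by simpa [j] using hx))
  have hjess : IsEssential (LinearMap.range j) := by
    intro L hL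
    have h1 : L.comap K.mkQ = K := by
      refine hK _ (fun x hx ↦ ?_) (eq_bot_iff.2 ?_)
      · simp [(Submodule.Quotient.mk_eq_zero K).2 hx]
      · rintro x ⟨hxN, hxL⟩
        have : j ⟨x, hxN⟩ ∈ LinearMap.range j ⊓ L := ⟨⟨_, rfl⟩, hxL⟩
        rw [hL, Submodule.mem_bot, map_eq_zero_iff _ hj] at this
        simpa using this
    rw [eq_bot_iff]
    intro y hy
    obtain ⟨x, rfl⟩ := K.mkQ_surjective y
    have : x ∈ L.comap K.mkQ := hy
    rw [h1] at this
    simpa using this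
  obtain ⟨h, hh⟩ := Module.Injective.out j hj N.subtype
  have hker : LinearMap.ker h = ⊥ := by
    refine hjess _ (eq_bot_iff.2 ?_)
    rintro _ ⟨⟨x, rfl⟩, hx⟩
    have hx : h (j x) = 0 := hx
    rw [hh] at hx
    have : x = 0 := by simpa using hx
    simp [this]
  have hrange : LinearMap.range h = N := by
    have hle : N ≤ LinearMap.range h := fun x hx ↦ ⟨j ⟨x, hx⟩, hh _⟩
    refine le_antisymm (hmax ⟨hN₀.trans hle, fun L hL hL0 ↦ ?_⟩ hle) hle
    have hNL : N ⊓ L = ⊥ := hess _ inf_le_left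
      (eq_bot_iff.2 ((inf_le_inf_left _ inf_le_right).trans hL0.le))
    have h2 : L.comap h = ⊥ := by
      refine hjess _ (eq_bot_iff.2 ?_)
      rintro _ ⟨⟨x, rfl⟩, hx⟩
      have hx : h (j x) ∈ L := hx
      rw [hh] at hx
      have : (x : Q) ∈ N ⊓ L := ⟨x.2, hx⟩
      rw [hNL] at this
      have : x = 0 := by simpa using this
      simp [this]
    rw [eq_bot_iff]
    intro y hy
    obtain ⟨x, rfl⟩ := hL hy
    have : x ∈ L.comap h := hy
    rw [h2] at this
    simp [(Submodule.mem_bot Λ).1 this]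
  refine ⟨ModuleCat.of Λ N, ι₀.codRestrict N fun x ↦ hN₀ ⟨x, rfl⟩,
    injective_of_retract N.subtype
      ((h ∘ₗ K.mkQ).codRestrict N fun x ↦ hrange ▸ LinearMap.mem_range_self h _)
      fun x ↦ Subtype.ext (hh x), fun x y hxy ↦ hι₀ (congrArg Subtype.val hxy), ?_⟩
  intro L hL
  have := hess (L.map N.subtype) (Submodule.map_subtype_le N L) (eq_bot_iff.2 ?_)
  · exact Submodule.map_injective_of_injective N.subtype_injective
      (this.trans (Submodule.map_bot _).symm)
  · rintro _ ⟨⟨m, rfl⟩, ⟨y, hy, hym⟩⟩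
    have hmem : y ∈ LinearMap.range (ι₀.codRestrict N fun x ↦ hN₀ ⟨x, rfl⟩) ⊓ L :=
      ⟨⟨m, Subtype.ext hym.symm⟩, hy⟩
    rw [hL] at hmem
    rw [← hym, (Submodule.mem_bot Λ).1 hmem]
    simp

/-- Λx is a module over the semisimple ring Λ/J, so N ∩ Λx has a complement in Λx; that complement
misses N and is zero by essentiality. -/
theorem mem_of_jacobson_smul_eq_zero [IsArtinianRing Λ] {E : Type u} [AddCommGroup E] [Module Λ E]
    {N : Submodule Λ E} (hN : IsEssential N) {x : E} (hx : ∀ r ∈ Ring.jacobson Λ, r • x = 0) :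
    x ∈ N := by
  let S := Submodule.span Λ {x}
  have htors : Module.IsTorsionBySet Λ S (Ring.jacobson Λ) := by
    rintro ⟨y, hy⟩ ⟨r, hr⟩
    obtain ⟨a, rfl⟩ := Submodule.mem_span_singleton.1 hy
    refine Subtype.ext ?_
    change r • a • x = 0
    rw [smul_smul]
    exact hx _ (Ideal.mul_mem_right _ _ hr)
  have hss : IsSemisimpleModule Λ S := by
    rw [← htors.isSemisimpleModule_iff]
    let _ := htors.module
    infer_instance
  obtain ⟨C, hC⟩ := exists_isCompl (N.comap S.subtype)
  have h1 : C.map S.subtype = ⊥ := by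
    refine hN _ (eq_bot_iff.2 ?_)
    rintro _ ⟨hyN, ⟨y, hy, rfl⟩⟩
    have : y ∈ N.comap S.subtype ⊓ C := ⟨hyN, hy⟩
    rw [hC.inf_eq_bot] at this
    simp [(Submodule.mem_bot Λ).1 this]
  replace h1 : C = ⊥ := Submodule.map_injective_of_injective S.subtype_injective
    (h1.trans (Submodule.map_bot _).symm)
  have h2 := hC.sup_eq_top
  rw [h1, sup_bot_eq] at h2
  have : (⟨x, Submodule.mem_span_singleton_self x⟩ : S) ∈ N.comap S.subtype := h2 ▸ trivial
  exact this

/-- The elements of a module annihilated by a power of the Jacobson radical. -/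
def annihilatedByRadicalPow (R : Type v) (Λ : Type u) [CommRing R] [Ring Λ] [Algebra R Λ]
    (E : Type u) [AddCommGroup E] [Module R E] [Module Λ E] [IsScalarTower R Λ E] (k : ℕ) :
    Submodule R E where
  carrier := {x | ∀ r ∈ Ring.jacobson Λ ^ k, r • x = 0}
  add_mem' hx hy r hr := by rw [smul_add, hx r hr, hy r hr, add_zero]
  zero_mem' r _ := smul_zero r
  smul_mem' c x hx r hr := by
    rw [← algebraMap_smul Λ c x, smul_smul, ← Algebra.commutes, ← smul_smul, hx r hr, smul_zero]

/-- An essential extension of a finitely generated module over an Artin algebra is finitely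
generated. -/
theorem finite_of_isEssential (R : Type v) [CommRing R] [IsArtinianRing R] [Algebra R Λ]
    [Module.Finite R Λ] {E : Type u} [AddCommGroup E]
    [Module Λ E] {N : Submodule Λ E} (hfin : Module.Finite Λ N) (hN : IsEssential N) :
    Module.Finite Λ E := by
  have : IsArtinianRing Λ := IsArtinianRing.of_finite R Λ
  let _ : Module R E := Module.compHom E (algebraMap R Λ)
  have : IsScalarTower R Λ E := ⟨fun c a x ↦ by
    rw [Algebra.smul_def, mul_smul]; rfl⟩
  let T := annihilatedByRadicalPow R Λ E
  have hnil : ∃ m, Ring.jacobson Λ ^ m = 0 := IsSemiprimaryRing.isNilpotent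
  have hT1 : IsNoetherian R (T 1) := by
    have : Module.Finite R N := Module.Finite.trans Λ N
    have : IsNoetherian R (N.restrictScalars R) :=
      inferInstanceAs (IsNoetherian R N)
    refine isNoetherian_of_le (t := N.restrictScalars R) fun x hx ↦ ?_
    exact mem_of_jacobson_smul_eq_zero hN fun r hr ↦ hx r (by rwa [Submodule.pow_one])
  have hT : ∀ k, IsNoetherian R (T k) := by
    intro k
    induction k with
    | zero =>
      have : T 0 = ⊥ := eq_bot_iff.2 fun x hx ↦ by
        simpa using hx 1 (by rw [Submodule.pow_zero, Ideal.one_eq_top]; trivial)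
      rw [this]
      infer_instance
    | succ k ih =>
      have : IsNoetherian R Λ := inferInstance
      obtain ⟨s, hs⟩ := IsNoetherian.noetherian ((Ring.jacobson Λ ^ k).restrictScalars R)
      have hsmem : ∀ r ∈ s, r ∈ Ring.jacobson Λ ^ k := fun r hr ↦ by
        have : r ∈ (Ring.jacobson Λ ^ k).restrictScalars R := hs ▸ Submodule.subset_span hr
        exact this
      have hle : T k ≤ T (k + 1) := fun x hx r hr ↦ hx r (Ideal.pow_le_pow_right k.le_succ hr)
      -- Multiplying by the finitely many R-generators of J^k lands in T 1, because J · J^k =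
      -- J^(k+1), and has kernel T k.
      let g : T (k + 1) →ₗ[R] (s → T 1) := LinearMap.pi fun i ↦
        { toFun := fun x ↦ ⟨(i : Λ) • (x : E), fun r hr ↦ by
            rw [smul_smul]
            refine x.2 _ ?_
            rw [Submodule.pow_one] at hr
            rw [Ideal.IsTwoSided.pow_succ]
            exact Ideal.mul_mem_mul hr (hsmem _ i.2)⟩
          map_add' := fun x y ↦ Subtype.ext (smul_add _ _ _)
          map_smul' := fun c x ↦ Subtype.ext (smul_comm (i : Λ) c (x : E)) }
      refine isNoetherian_of_range_eq_ker (Submodule.inclusion hle) g ?_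
      ext x
      rw [Submodule.range_inclusion, LinearMap.mem_ker]
      constructor
      · intro hx
        ext i
        exact hx _ (hsmem _ i.2)
      · intro hx r hr
        have hr' : r ∈ Submodule.span R (s : Set Λ) := by rw [hs]; exact hr
        change r • (x : E) = 0
        clear hr
        induction hr' using Submodule.span_induction with
        | mem r hr => exact congrArg Subtype.val (congrFun hx ⟨r, hr⟩)
        | zero => simp
        | add a b _ _ ha hb => rw [add_smul, ha, hb, add_zero]
        | smul c a _ ha => rw [smul_assoc, ha, smul_zero]
  obtain ⟨m, hm⟩ := hnil
  have htop : T m = ⊤ := eq_top_iff.2 fun x _ r hr ↦ by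
    rw [hm] at hr
    simp [(Submodule.mem_bot Λ).1 hr]
  have := hT m
  rw [htop, isNoetherian_top_iff] at this
  exact Module.Finite.of_restrictScalars_finite R Λ E

/-- A short exact sequence `0 → X → I → Y → 0` in which `I` is a finitely generated injective
envelope of `X`. -/
def IsMinimalCosyzygyOf (Y X : ModuleCat.{u} Λ) : Prop :=
  ∃ (I : ModuleCat.{u} Λ) (ι : X →ₗ[Λ] I) (g : I →ₗ[Λ] Y), Module.Finite Λ I ∧
    Module.Injective Λ I ∧ Function.Injective ι ∧ IsEssential (LinearMap.range ι) ∧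
    Function.Surjective g ∧ Function.Exact ι g

theorem exists_isMinimalCosyzygyOf (R : Type v) [CommRing R] [IsArtinianRing R] [Algebra R Λ]
    [Module.Finite R Λ] (X : ModuleCat.{u} Λ) [Module.Finite Λ X] :
    ∃ Y : ModuleCat.{u} Λ, Module.Finite Λ Y ∧ IsMinimalCosyzygyOf Y X := by
  obtain ⟨E, ι, hE, hι, hess⟩ := exists_injective_hull (Λ := Λ) X
  have : Module.Finite Λ E := finite_of_isEssential R (Module.Finite.range ι) hess
  exact ⟨ModuleCat.of Λ (E ⧸ LinearMap.range ι),
    inferInstanceAs (Module.Finite Λ (E ⧸ LinearMap.range ι)), E, ι,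
    (LinearMap.range ι).mkQ, this, hE, hι, hess, Submodule.mkQ_surjective _,
    LinearMap.exact_map_mkQ_range ι⟩

theorem minimalInjectiveCoresolution_of_chain (Z : ℕ → ModuleCat.{u} Λ)
    (h : ∀ k, IsMinimalCosyzygyOf (Z (k + 1)) (Z k)) :
    Nonempty (MinimalInjectiveCoresolution Λ (Z 0)) := by
  choose I ι g hfin hinj hι hess hg hex using h
  refine ⟨⟨I, ι 0, fun k ↦ ι (k + 1) ∘ₗ g k, hfin, hinj, hι 0, fun y ↦ ?_, fun k y ↦ ?_, hess 0,
    fun k ↦ ?_⟩⟩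
  · rw [← hex 0 y]
    exact map_eq_zero_iff _ (hι _)
  · change ι (k + 1 + 1) (g (k + 1) y) = 0 ↔ _
    rw [map_eq_zero_iff _ (hι _), hex (k + 1) y]
    constructor
    · rintro ⟨x, rfl⟩
      obtain ⟨w, rfl⟩ := hg k x
      exact ⟨w, rfl⟩
    · rintro ⟨w, rfl⟩
      exact ⟨g k w, rfl⟩
  · rw [LinearMap.range_comp_of_range_eq_top _ (LinearMap.range_eq_top.2 (hg k))]
    exact hess (k + 1)

/-- Finitely generated modules over Artin algebras have minimal injective coresolutions. -/
theorem exists_minimalInjectiveCoresolution (R : Type v) [CommRing R] [IsArtinianRing R]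
    [Algebra R Λ] [Module.Finite R Λ] (M : Type u) [AddCommGroup M] [Module Λ M]
    [Module.Finite Λ M] : Nonempty (MinimalInjectiveCoresolution Λ M) := by
  let T := {X : ModuleCat.{u} Λ // Module.Finite Λ X}
  have hs : ∀ X : T, ∃ Y : T, IsMinimalCosyzygyOf Y.1 X.1 := fun X ↦ by
    have := X.2
    obtain ⟨Y, hY, h⟩ := exists_isMinimalCosyzygyOf R X.1
    exact ⟨⟨Y, hY⟩, h⟩
  choose s hs using hs
  let x : T := ⟨ModuleCat.of Λ M, ‹_›⟩
  exact minimalInjectiveCoresolution_of_chain (fun k ↦ (s^[k] x).1) fun k ↦ by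
    rw [Function.iterate_succ_apply']
    exact hs _

end InjectiveHull

end AuslanderGorenstein

namespace AuslanderGorenstein

/-! ### The two inclusions and the dominant dimension. -/

section Main

variable {Λ : Type u} [Ring Λ]

theorem socle_le_of_isEssential {M : Type u} [AddCommGroup M] [Module Λ M] {N : Submodule Λ M}
    (hN : IsEssential N) : socle Λ M ≤ N := by
  refine sSup_le fun S hS ↦ ?_
  have hatom : IsAtom S := isSimpleModule_iff_isAtom.1 hS
  rcases hatom.le_iff.1 (inf_le_right : N ⊓ S ≤ S) with h | h
  · exact absurd (hN S h) hatom.1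
  · exact inf_eq_right.1 h

theorem ExtVanish.of_injective {n : ℕ} (hn : ∀ (Y : Type u) [AddCommGroup Y] [Module Λ Y],
    ExtVanish Λ Y Λ (n + 1)) {X Y : Type u} [AddCommGroup X] [AddCommGroup Y] [Module Λ X]
    [Module Λ Y] (f : X →ₗ[Λ] Y) (hf : Function.Injective f) (hY : ExtVanish Λ Y Λ n) :
    ExtVanish Λ X Λ n :=
  ExtVanish.submodule hf (LinearMap.range f).mkQ_surjective (LinearMap.exact_map_mkQ_range f) hY
    (hn _)

namespace MinimalInjectiveCoresolution

variable (C : MinimalInjectiveCoresolution Λ Λ)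

/-- The identification of `Λ` with the kernel of the first differential. -/
noncomputable def kerEquiv : Λ ≃ₗ[Λ] LinearMap.ker (C.d 0) :=
  (LinearEquiv.ofInjective C.ε C.ε_injective).trans
    (LinearEquiv.ofEq _ _ (LinearMap.exact_iff.1 C.exact_zero).symm)

theorem socle_le_ker (j : ℕ) : socle Λ (C.I j) ≤ LinearMap.ker (C.d j) := by
  cases j with
  | zero => exact LinearMap.exact_iff.1 C.exact_zero ▸ socle_le_of_isEssential C.essential_ε
  | succ j =>
    exact LinearMap.exact_iff.1 (C.exact_succ j) ▸ socle_le_of_isEssential (C.essential_d j)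

/-- Shifting along cosyzygies reduces Ext^i to maps from X into ker d_{j+i} ⊆ I_{j+i}. -/
theorem extVanish_ker_of_hom_eq_zero {X : Type u} [AddCommGroup X] [Module Λ X] (i : ℕ) :
    ∀ j, (∀ l, l ≤ j + i → ∀ f : X →ₗ[Λ] C.I l, f = 0) →
      ExtVanish Λ X (LinearMap.ker (C.d j)) i := by
  induction i with
  | zero =>
    intro j h
    refine extVanish_zero fun f ↦ ?_
    have := h j le_rfl ((LinearMap.ker (C.d j)).subtype ∘ₗ f)
    ext x
    exact LinearMap.congr_fun this x
  | succ i ih =>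
    intro j h
    obtain ⟨g, hg, -, hex⟩ := exists_surjective_onto_ker (C.exact_succ j)
    have := C.injective j
    exact ExtVanish.covariant (Submodule.subtype_injective _) hg hex
      (ih (j + 1) fun l hl ↦ h l (by omega)) (extVanish_of_injective i)

theorem extVanish_of_hom_eq_zero {X : Type u} [AddCommGroup X] [Module Λ X] {i : ℕ}
    (h : ∀ l, l ≤ i → ∀ f : X →ₗ[Λ] C.I l, f = 0) : ExtVanish Λ X Λ i :=
  (C.extVanish_ker_of_hom_eq_zero i 0 (by simpa using h)).congr_right C.kerEquiv

/-- 0 → Λ → I_0 → ⋯ → I_{j-1} → ker d_j → 0 is a projective resolution of length j. -/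
theorem extVanish_ker_of_projective (j : ℕ) (h : ∀ l < j, Module.Projective Λ (C.I l)) :
    ∀ i, j ≤ i → ExtVanish Λ (LinearMap.ker (C.d j)) Λ (i + 1) := by
  induction j with
  | zero => exact fun i _ ↦ (extVanish_of_projective i).congr C.kerEquiv.symm
  | succ j ih =>
    intro i hi
    obtain ⟨i, rfl⟩ : ∃ l, i = l + 1 := ⟨i - 1, by omega⟩
    obtain ⟨g, hg, -, hex⟩ := exists_surjective_onto_ker (C.exact_succ j)
    have := h j j.lt_succ_self
    exact ExtVanish.quotient (Submodule.subtype_injective _) hg hex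
      (ih (fun l hl ↦ h l (by omega)) i (by omega)) (extVanish_of_projective _)

end MinimalInjectiveCoresolution

theorem le_dominantDimension_iff {n : ℕ} :
    ((n + 1 : ℕ) : ℕ∞) ≤ dominantDimension Λ ↔ ∃ C : MinimalInjectiveCoresolution Λ Λ,
      ∀ j ≤ n, Module.Projective Λ (C.I j) := by
  constructor
  · intro h
    have h' : (n : ℕ∞) < dominantDimension Λ :=
      lt_of_lt_of_le (by exact_mod_cast n.lt_succ_self) h
    -- Replacing n + 1 ≤ sup by n < sup yields one t, and so one coresolution, serving all j ≤ n.
    obtain ⟨t, ⟨C, hC⟩, ht⟩ := lt_sSup_iff.1 h'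
    exact ⟨C, fun j hj ↦ hC j (lt_of_le_of_lt (by exact_mod_cast hj) ht)⟩
  · rintro ⟨C, hC⟩
    exact le_sSup ⟨C, fun j hj ↦ hC j (Nat.lt_succ_iff.1 (by exact_mod_cast hj))⟩

theorem gorensteinProjectiveDimension_le_iff {M : Type u} [AddCommGroup M] [Module Λ M] {n : ℕ} :
    gorensteinProjectiveDimension Λ M ≤ n ↔ ∃ k ≤ n, HasGorensteinResolution Λ k M := by
  constructor
  · intro h
    have h' : gorensteinProjectiveDimension Λ M < ((n + 1 : ℕ) : ℕ∞) :=
      lt_of_le_of_lt h (by exact_mod_cast n.lt_succ_self)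
    obtain ⟨_, ⟨k, rfl, hk⟩, hlt⟩ := sInf_lt_iff.1 h'
    exact ⟨k, Nat.lt_succ_iff.1 (by exact_mod_cast hlt), hk⟩
  · rintro ⟨k, hk, h⟩
    have hkn : (k : ℕ∞) ≤ n := by exact_mod_cast hk
    exact le_trans (sInf_le ⟨k, rfl, h⟩) hkn

theorem injective_prod {M N : Type u} [AddCommGroup M] [AddCommGroup N] [Module Λ M] [Module Λ N]
    [Module.Injective Λ M] [Module.Injective Λ N] : Module.Injective Λ (M × N) where
  out X Y _ _ _ _ f hf g := by
    obtain ⟨h₁, H₁⟩ := Module.Injective.out f hf (LinearMap.fst Λ M N ∘ₗ g)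
    obtain ⟨h₂, H₂⟩ := Module.Injective.out f hf (LinearMap.snd Λ M N ∘ₗ g)
    exact ⟨h₁.prod h₂, fun x ↦ Prod.ext (H₁ x) (H₂ x)⟩

/-- An injective Artinian module is projective if every simple submodule of it maps nontrivially
to a module that is projective and injective. -/
theorem projective_of_forall_simple {I : Type u} [AddCommGroup I] [Module Λ I] [IsArtinian Λ I]
    [Module.Injective Λ I]
    (h : ∀ S : Submodule Λ I, IsSimpleModule Λ S → ∃ (W : ModuleCat.{u} Λ) (f : S →ₗ[Λ] W),
      Module.Projective Λ W ∧ Module.Injective Λ W ∧ f ≠ 0) : Module.Projective Λ I := by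
  obtain ⟨K, ⟨W, hP, hI, f, rfl⟩, hmin⟩ := IsArtinian.set_has_minimal
    {K : Submodule Λ I | ∃ W : ModuleCat.{u} Λ, Module.Projective Λ W ∧ Module.Injective Λ W ∧
      ∃ f : I →ₗ[Λ] W, K = LinearMap.ker f}
    ⟨⊤, ModuleCat.of Λ PUnit.{u + 1}, inferInstanceAs (Module.Projective Λ PUnit.{u + 1}),
      ⟨fun _ _ _ _ _ _ _ _ _ ↦ ⟨0, fun _ ↦ rfl⟩⟩, 0, by simp⟩
  have hker : LinearMap.ker f = ⊥ := by
    rcases eq_bot_or_exists_atom_le (LinearMap.ker f) with h0 | ⟨S, hS, hle⟩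
    · exact h0
    obtain ⟨W', g₀, hP', hI', hg₀⟩ := h S (isSimpleModule_iff_isAtom.2 hS)
    obtain ⟨g, hg⟩ := Module.Injective.out S.subtype S.subtype_injective g₀
    -- A simple S inside a minimal nonzero kernel is not killed by the extension g, so adding g as a
    -- component shrinks the kernel.
    have hlt : LinearMap.ker (f.prod g) < LinearMap.ker f := by
      rw [LinearMap.ker_prod]
      refine lt_of_le_of_ne inf_le_left fun heq ↦ hg₀ ?_
      ext x
      have : (x : I) ∈ LinearMap.ker g := (heq.ge (hle x.2)).2
      rw [← hg x]
      exact this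
    exact absurd hlt (hmin _ ⟨ModuleCat.of Λ (W × W'),
      inferInstanceAs (Module.Projective Λ (W × W')), injective_prod, f.prod g, rfl⟩)
  obtain ⟨r, hr⟩ := Module.Injective.out f (LinearMap.ker_eq_bot.1 hker) LinearMap.id
  exact Module.Projective.of_split f r (LinearMap.ext hr)

theorem IsPerp.eq_zero_of_dual_eq_zero [IsNoetherianRing Λ] [IsNoetherianRing Λᵐᵒᵖ] {N : ℕ}
    (hΛ : IsGorensteinLT N Λ) {M : Type u} [AddCommGroup M] [Module Λ M] (hM : IsPerp Λ Λ M)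
    (h : ∀ f : M →ₗ[Λ] Λ, f = 0) (x : M) : x = 0 := by
  have := projective_mulOpposite_self (A := Λ)
  refine (bidualEval_bijective (B := Λᵐᵒᵖ) hΛ.right (bidualEval_free_bijective Λ) hM).1 ?_
  rw [map_zero]
  ext f
  rw [h f]
  rfl

theorem IsGorensteinOfDimension.isGorensteinLT {m : ℕ} (hΛ : IsGorensteinOfDimension m Λ) :
    ∃ N, IsGorensteinLT N Λ := by
  obtain ⟨k, hk⟩ := (injectiveDimension_ne_top_iff _).1 hΛ.right_finite.ne
  -- Any bound exceeding both m and k works.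
  refine ⟨m + k + 1, fun Y _ _ i hi ↦ ?_, fun Y _ _ i hi ↦ ?_⟩
  · exact extVanish_of_injectiveDimension_le (m := m) hΛ.left_eq.le (by omega)
  · have e : Λ ≃ₗ[Λᵐᵒᵖ] Λᵐᵒᵖ := (LinearEquiv.ofBijective (LinearMap.toSpanSingleton Λᵐᵒᵖ Λ 1)
      ⟨fun x y h ↦ by simpa using h, fun x ↦ ⟨MulOpposite.op x, by simp⟩⟩).symm
    exact (extVanish_of_injectiveDimension_le ((injectiveDimension_le_iff _ _).2 hk)
      (by omega)).congr_right e

variable {n : ℕ}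

theorem prinj_le_injWithSocleGpdLE [IsNoetherianRing Λ] [IsNoetherianRing Λᵐᵒᵖ]
    (hΛ : IsGorensteinOfDimension (n + 1) Λ) : prinj Λ ≤ injWithSocleGpdLE n Λ := by
  rintro I ⟨hfin, hproj, hinj⟩
  refine ⟨hfin, hinj, gorensteinProjectiveDimension_le_iff.2 ⟨n, le_rfl, ?_⟩⟩
  obtain ⟨N, hN⟩ := hΛ.isGorensteinLT
  refine hasGorensteinResolution_of_extVanish hN n _ fun i hi ↦ ?_
  refine ExtVanish.of_injective (fun Y _ _ ↦ ?_) (socle Λ I).subtype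
    (Submodule.subtype_injective _) (extVanish_of_projective i)
  exact extVanish_of_injectiveDimension_le hΛ.left_eq.le (by omega)

theorem injWithSocleGpdLE_le_prinj [IsArtinianRing Λ] [IsNoetherianRing Λᵐᵒᵖ]
    (hΛ : IsGorensteinOfDimension (n + 1) Λ) (C : MinimalInjectiveCoresolution Λ Λ)
    (hC : ∀ j ≤ n, Module.Projective Λ (C.I j)) : injWithSocleGpdLE n Λ ≤ prinj Λ := by
  rintro I ⟨hfin, hinj, hsoc⟩
  refine ⟨hfin, ?_, hinj⟩
  obtain ⟨k, hk, hres⟩ := gorensteinProjectiveDimension_le_iff.1 hsoc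
  obtain ⟨N, hN⟩ := hΛ.isGorensteinLT
  refine projective_of_forall_simple fun S hS ↦ ?_
  by_contra! hcon
  have hzero : ∀ l ≤ n, ∀ f : S →ₗ[Λ] C.I l, f = 0 :=
    fun l hl f ↦ hcon (C.I l) f (hC l hl) (C.injective l)
  have hperp : IsPerp Λ Λ S := by
    refine ⟨inferInstance, fun i ↦ ?_⟩
    rcases lt_or_ge i n with hi | hi
    · exact C.extVanish_of_hom_eq_zero fun l hl ↦ hzero l (by omega)
    · have hle : S ≤ socle Λ I := le_sSup hS
      exact ExtVanish.of_injective
        (fun Y _ _ ↦ extVanish_of_injectiveDimension_le hΛ.left_eq.le (by omega))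
        (Submodule.inclusion hle) (Submodule.inclusion_injective hle)
        (HasGorensteinResolution.extVanish k _ hres i (by omega))
  have hdual : ∀ f : S →ₗ[Λ] Λ, f = 0 := fun f ↦ by
    ext x
    have := LinearMap.congr_fun (hzero 0 n.zero_le (C.ε ∘ₗ f)) x
    exact C.ε_injective (by simpa using this)
  obtain ⟨x, hx⟩ := @exists_ne _ (IsSimpleModule.nontrivial Λ S) 0
  exact hx (hperp.eq_zero_of_dual_eq_zero hN hdual x)

theorem projective_of_injWithSocleGpdLE_le_prinj [IsNoetherianRing Λ] [IsNoetherianRing Λᵐᵒᵖ]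
    (hΛ : IsGorensteinOfDimension (n + 1) Λ) (h : injWithSocleGpdLE n Λ ≤ prinj Λ)
    (C : MinimalInjectiveCoresolution Λ Λ) (j : ℕ) (hj : j ≤ n) : Module.Projective Λ (C.I j) := by
  obtain ⟨N, hN⟩ := hΛ.isGorensteinLT
  induction j using Nat.strong_induction_on with
  | _ j ih =>
    have := C.finite j
    refine (h (C.I j) ⟨C.finite j, C.injective j,
      gorensteinProjectiveDimension_le_iff.2 ⟨n, le_rfl, ?_⟩⟩).2.1
    refine hasGorensteinResolution_of_extVanish hN n _ fun i hi ↦ ?_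
    exact ExtVanish.of_injective
      (fun Y _ _ ↦ extVanish_of_injectiveDimension_le hΛ.left_eq.le (by omega))
      (Submodule.inclusion (C.socle_le_ker j)) (Submodule.inclusion_injective _)
      (C.extVanish_ker_of_projective j (fun l hl ↦ ih l hl (by omega)) i (by omega))

end Main

end AuslanderGorenstein

theorem theorem4p1 {R : Type v} [CommRing R] [IsArtinianRing R]
    {Λ : Type u} [Ring Λ] [Algebra R Λ] [Module.Finite R Λ] (n : ℕ)
    (hΛ : AuslanderGorenstein.IsGorensteinOfDimension (n + 1) Λ) :
    AuslanderGorenstein.IsMinimalAuslanderGorenstein n Λ ↔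
      AuslanderGorenstein.prinj Λ = AuslanderGorenstein.injWithSocleGpdLE n Λ := by
  have : IsArtinianRing Λ := IsArtinianRing.of_finite R Λ
  have : Module.Finite R Λᵐᵒᵖ := Module.Finite.equiv (MulOpposite.opLinearEquiv R)
  have : IsArtinianRing Λᵐᵒᵖ := IsArtinianRing.of_finite R Λᵐᵒᵖ
  constructor
  · intro h
    obtain ⟨C, hC⟩ := AuslanderGorenstein.le_dominantDimension_iff.1 h.le_dominantDimension
    exact le_antisymm (AuslanderGorenstein.prinj_le_injWithSocleGpdLE hΛ)
      (AuslanderGorenstein.injWithSocleGpdLE_le_prinj hΛ C hC)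
  · intro h
    obtain ⟨C⟩ := AuslanderGorenstein.exists_minimalInjectiveCoresolution R (Λ := Λ) Λ
    exact ⟨hΛ.left_eq.le, AuslanderGorenstein.le_dominantDimension_iff.2
      ⟨C, AuslanderGorenstein.projective_of_injWithSocleGpdLE_le_prinj hΛ h.ge C⟩⟩
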